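/- Let $k$ be a number field and let $F$ be an étale $k$-algebra, i.e. a finite product $F\simeq F_1\times\dots\times F_r$ of finite (separable) field extensions of $k$. All tensor products are over $k$; the algebras $F^{\otimes 2}$ and $F^{\otimes 3}$ are again étale. For an étale $k$-algebra $G\simeq G_1\times\dots\times G_s$ let $\mathrm{Pl}(G)=\bigsqcup_j \mathrm{Pl}(G_j)$ be the disjoint union of the sets of non-archimedean places of the number fields $G_j$, and let $\mathrm{Div}(G)$ be the free abelian group on $\mathrm{Pl}(G)$. A homomorphism of $k$-algebras $f\colon G\to G'$ between étale algebras induces a homomorphism $\mathrm{Div}(f)\colon \mathrm{Div}(G)\to\mathrm{Div}(G')$: for $P\in\mathrm{Pl}(G_i)$, $$\mathrm{Div}(f)(P)=\sum_{j\,:\,f_{ij}\neq 0}\ \sum_{Q\in \mathrm{Pl}(G'_j),\ Q\mid P} e(Q/P)\,Q,$$ where $f_{ij}\colon G_i\to G'_j$ are the components of $f$ (each is zero or a field embedding) and $e(Q/P)$ is the ramification index of $Q$ over $P$ with respect to the embedding $f_{ij}$. Let $\varepsilon^n_i\colon F^{\otimes n+1}\to F^{\otimes n+2}$ $(0\le i\le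 n+1)$ be the homomorphism which inserts $1$ in position $i$, i.e. $f_0\otimes\dots\otimes f_n\mapsto f_0\otimes\dots\otimes f_{i-1}\otimes 1\otimes f_i\otimes\dots\otimes f_n$, and put $$\mathrm{Div}(\Delta^n_{Am})=\sum_{i=0}^{n+1}(-1)^i\,\mathrm{Div}(\varepsilon^n_i)\colon \mathrm{Div}(F^{\otimes n+1})\to \mathrm{Div}(F^{\otimes n+2}).$$ Say that a non-archimedean place $P$ of $k$ ramifies in $F$ if $e(Q/P)\neq 1$ for some place $Q$ of $F$ above $P$. Let $D\in\mathrm{Div}(F^{\otimes 2})$ be such that $\mathrm{Div}(\Delta^1_{Am})(D)=0$ and such that no place in the support of $D$ lies above a place of $k$ that ramifies in $F$. Then there exists $E\in\mathrm{Div}(F)$ such that $D=\mathrm{Div}(\Delta^0_{Am})(E)$. -/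

import Mathlib

open scoped TensorProduct NumberField
open IsDedekindDomain

namespace EtaleDivisor

/-! ### Factors and non-archimedean places of an étale algebra

A finite étale algebra `F` over a field is the product of the fields `F ⧸ 𝔪`, where `𝔪` runs over
the (finitely many) maximal ideals of `F`. -/

/-- The factor of `F` cut out by the maximal ideal `𝔪`, that is, the field `F ⧸ 𝔪`. -/
def Factor {F : Type*} [CommRing F] (𝔪 : MaximalSpectrum F) : Type _ := F ⧸ 𝔪.asIdeal

noncomputable instance {F : Type*} [CommRing F] (𝔪 : MaximalSpectrum F) : Field (Factor 𝔪) :=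
  haveI := 𝔪.isMaximal
  Ideal.Quotient.field 𝔪.asIdeal

noncomputable instance {k F : Type*} [Field k] [CommRing F] [Algebra k F] (𝔪 : MaximalSpectrum F) :
    Algebra k (Factor 𝔪) :=
  inferInstanceAs (Algebra k (F ⧸ 𝔪.asIdeal))

instance {k F : Type*} [Field k] [CommRing F] [Algebra k F] [Module.Finite k F]
    (𝔪 : MaximalSpectrum F) : Module.Finite k (Factor 𝔪) :=
  inferInstanceAs (Module.Finite k (F ⧸ 𝔪.asIdeal))

theorem numberField_factor (k : Type*) {F : Type*} [Field k] [NumberField k] [CommRing F]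
    [Algebra k F] [Module.Finite k F] (𝔪 : MaximalSpectrum F) : NumberField (Factor 𝔪) :=
  NumberField.of_module_finite k (Factor 𝔪)

/-- The set of non-archimedean places of `F`: the disjoint union, over the factors of `F` (which
are number fields), of the sets of nonzero prime ideals of their rings of integers. -/
def Place (F : Type*) [CommRing F] : Type _ :=
  Σ 𝔪 : MaximalSpectrum F, HeightOneSpectrum (𝓞 (Factor 𝔪))

/-- The divisor group of `F`: the free abelian group on the places of `F`. -/
abbrev Divisor (F : Type*) [CommRing F] : Type _ := Place F →₀ ℤ

/-! ### The action of algebra homomorphisms on places and divisors -/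

section Functoriality

variable {k : Type*} [Field k]
variable {F : Type*} [CommRing F] [Algebra k F] [Module.Finite k F]
variable {F' : Type*} [CommRing F'] [Algebra k F']

/-- The index `i` of the only factor `F_i` of `F` such that the component `F_i → F'_j` of
`f : F → F'` is nonzero, where `F'_j` is the factor of `F'` given by `𝔪`. -/
def comapFactor (f : F →ₐ[k] F') (𝔪 : MaximalSpectrum F') : MaximalSpectrum F where
  asIdeal := 𝔪.asIdeal.comap f
  isMaximal := by
    have := 𝔪.isMaximal
    have : IsArtinianRing F := IsArtinianRing.of_finite k F
    have : (𝔪.asIdeal.comap f).IsPrime := Ideal.comap_isPrime f 𝔪.asIdeal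
    exact IsArtinianRing.isMaximal_of_isPrime _

/-- The nonzero component `F_i → F'_j` of `f : F → F'`, an embedding of fields. -/
def component (f : F →ₐ[k] F') (𝔪 : MaximalSpectrum F') :
    Factor (comapFactor f 𝔪) →+* Factor 𝔪 :=
  Ideal.quotientMap 𝔪.asIdeal (f : F →+* F') le_rfl

/-- The embedding of rings of integers induced by `component f 𝔪`. -/
noncomputable def integerComponent (f : F →ₐ[k] F') (𝔪 : MaximalSpectrum F') :
    𝓞 (Factor (comapFactor f 𝔪)) →+* 𝓞 (Factor 𝔪) :=
  NumberField.RingOfIntegers.mapRingHom (component f 𝔪)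

theorem integerComponent_isIntegral (f : F →ₐ[k] F') (𝔪 : MaximalSpectrum F') :
    (integerComponent f 𝔪).IsIntegral := by
  intro x
  have hx : IsIntegral ℤ x := Algebra.IsIntegral.isIntegral x
  obtain ⟨p, hp, hpx⟩ := hx
  refine ⟨p.map (algebraMap ℤ _), hp.map _, ?_⟩
  rw [Polynomial.eval₂_map, ← hpx]
  congr 1
  exact RingHom.ext_int _ _

/-- The place of `F` below the place `Q` of `F'`, for a homomorphism `f : F → F'`. -/
noncomputable def below (f : F →ₐ[k] F') (Q : Place F') : Place F :=
  ⟨comapFactor f Q.1,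
    { asIdeal := Q.2.asIdeal.comap (integerComponent f Q.1)
      isPrime := Q.2.isPrime.comap _
      ne_bot := by
        let := (integerComponent f Q.1).toAlgebra
        have : Algebra.IsIntegral (𝓞 (Factor (comapFactor f Q.1))) (𝓞 (Factor Q.1)) :=
          ⟨integerComponent_isIntegral f Q.1⟩
        exact mt Ideal.eq_bot_of_comap_eq_bot Q.2.ne_bot }⟩

/-- The ramification index of the place `Q` of `F'` over the place of `F` below it. -/
noncomputable def ramIdx (f : F →ₐ[k] F') (Q : Place F') : ℕ :=
  letI := (integerComponent f Q.1).toAlgebra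
  Q.2.asIdeal.ramificationIdx (𝓞 (Factor (comapFactor f Q.1)))

/-- There are finitely many places of `F'` above a given place of `F`. -/
theorem finite_above [NumberField k] [Module.Finite k F'] (f : F →ₐ[k] F') (P : Place F) :
    {Q : Place F' | below f Q = P}.Finite := by
  have : IsArtinianRing F' := IsArtinianRing.of_finite k F'
  have key : ∀ 𝔪 : MaximalSpectrum F',
      {q : HeightOneSpectrum (𝓞 (Factor 𝔪)) | below f ⟨𝔪, q⟩ = P}.Finite := by
    intro 𝔪
    have := numberField_factor k 𝔪
    have := numberField_factor k (comapFactor f 𝔪)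
    by_cases h : ∃ q₀ : HeightOneSpectrum (𝓞 (Factor 𝔪)), below f ⟨𝔪, q₀⟩ = P
    · obtain ⟨q₀, rfl⟩ := h
      let := (integerComponent f 𝔪).toAlgebra
      have : Algebra.IsIntegral (𝓞 (Factor (comapFactor f 𝔪))) (𝓞 (Factor 𝔪)) :=
        ⟨integerComponent_isIntegral f 𝔪⟩
      have : FaithfulSMul (𝓞 (Factor (comapFactor f 𝔪))) (𝓞 (Factor 𝔪)) := by
        rw [faithfulSMul_iff_algebraMap_injective]
        intro x y hxy
        exact NumberField.RingOfIntegers.ext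
          ((component f 𝔪).injective (congrArg (fun z : 𝓞 (Factor 𝔪) => (z : Factor 𝔪)) hxy))
      have : Module.IsTorsionFree (𝓞 (Factor (comapFactor f 𝔪))) (𝓞 (Factor 𝔪)) :=
        inferInstance
      let p : HeightOneSpectrum (𝓞 (Factor (comapFactor f 𝔪))) := (below f ⟨𝔪, q₀⟩).2
      have : p.asIdeal.IsMaximal := p.isMaximal
      have hfin := IsDedekindDomain.primesOver_finite p.asIdeal (𝓞 (Factor 𝔪))
      refine Set.Finite.of_finite_image (f := HeightOneSpectrum.asIdeal) (hfin.subset ?_)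
        (fun _ _ _ _ h => HeightOneSpectrum.ext h)
      rintro _ ⟨q, hq, rfl⟩
      refine ⟨q.isPrime, ⟨?_⟩⟩
      have h2 := (Sigma.mk.inj_iff.mp hq).2
      exact (congrArg HeightOneSpectrum.asIdeal (eq_of_heq h2)).symm
    · convert Set.finite_empty
      ext q
      simpa using fun hq => h ⟨q, hq⟩
  refine (Set.finite_iUnion fun 𝔪 => (key 𝔪).image (Sigma.mk 𝔪)).subset ?_
  rintro ⟨𝔪, q⟩ hq
  exact Set.mem_iUnion.mpr ⟨𝔪, q, hq, rfl⟩

/-- The homomorphism `Div(F) → Div(F')` induced by `f : F → F'`: it sends a place `P` of `F` to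
`∑ e_Q • Q`, where `Q` runs over the places of `F'` above `P` and `e_Q` is the ramification index. -/
noncomputable def divMap [NumberField k] [Module.Finite k F'] (f : F →ₐ[k] F') :
    Divisor F →+ Divisor F' :=
  Finsupp.liftAddHom fun P : Place F =>
    (zmultiplesHom (Divisor F')
      (∑ Q ∈ (finite_above f P).toFinset, Finsupp.single Q (ramIdx f Q : ℤ)))

/-- The place `P` of `F` ramifies through `f : F → F'`. -/
def Ramifies (f : F →ₐ[k] F') (P : Place F) : Prop :=
  ∃ Q : Place F', below f Q = P ∧ ramIdx f Q ≠ 1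

end Functoriality

/-- An étale algebra over a field is finite-dimensional. -/
instance finite_of_etale (k F : Type*) [Field k] [CommRing F] [Algebra k F] [Algebra.Etale k F] :
    Module.Finite k F :=
  Algebra.FormallyUnramified.finite_of_free k F

/-! ### The Amitsur complex in low degrees -/

section Amitsur

variable (k F : Type*) [Field k] [CommRing F] [Algebra k F]

/-- `ε₀⁰ : F → F ⊗ F`, `a ↦ 1 ⊗ a`. -/
noncomputable def eps00 : F →ₐ[k] F ⊗[k] F := Algebra.TensorProduct.includeRight

/-- `ε₁⁰ : F → F ⊗ F`, `a ↦ a ⊗ 1`. -/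
noncomputable def eps01 : F →ₐ[k] F ⊗[k] F := Algebra.TensorProduct.includeLeft

/-- `ε₀¹ : F ⊗ F → F ⊗ F ⊗ F`, `a ⊗ b ↦ 1 ⊗ a ⊗ b`. -/
noncomputable def eps10 : F ⊗[k] F →ₐ[k] F ⊗[k] (F ⊗[k] F) :=
  Algebra.TensorProduct.includeRight

/-- `ε₁¹ : F ⊗ F → F ⊗ F ⊗ F`, `a ⊗ b ↦ a ⊗ 1 ⊗ b`. -/
noncomputable def eps11 : F ⊗[k] F →ₐ[k] F ⊗[k] (F ⊗[k] F) :=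
  Algebra.TensorProduct.map (AlgHom.id k F) Algebra.TensorProduct.includeRight

/-- `ε₂¹ : F ⊗ F → F ⊗ F ⊗ F`, `a ⊗ b ↦ a ⊗ b ⊗ 1`. -/
noncomputable def eps12 : F ⊗[k] F →ₐ[k] F ⊗[k] (F ⊗[k] F) :=
  Algebra.TensorProduct.map (AlgHom.id k F) Algebra.TensorProduct.includeLeft

variable [NumberField k] [Module.Finite k F]

/-- The Amitsur differential on divisors `Div(F) → Div(F ⊗ F)`. -/
noncomputable def divDelta0 : Divisor F →+ Divisor (F ⊗[k] F) :=
  divMap (eps00 k F) - divMap (eps01 k F)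

/-- The Amitsur differential on divisors `Div(F ⊗ F) → Div(F ⊗ F ⊗ F)`. -/
noncomputable def divDelta1 : Divisor (F ⊗[k] F) →+ Divisor (F ⊗[k] (F ⊗[k] F)) :=
  divMap (eps10 k F) - divMap (eps11 k F) + divMap (eps12 k F)

end Amitsur

end EtaleDivisor

/-! Read a place `Q` of `F ⊗ F` as an arrow from `below eps01 Q` to `below eps00 Q`, two places of
`F` over the same place of `k`. Any two such places are joined by an arrow, and any two composable
arrows are outer faces of a place of `F ⊗ F ⊗ F`; both facts come from `exists_common_place`, that
is, from transitivity of a Galois group on primes.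

Over a place of `k` unramified in `F`, all ramification indices that occur are 1, since inertia
acting trivially on both tensor factors acts trivially on the product
(`ramIdx_tensorProduct_eq_one`). There the cocycle condition says that `D` is additive on some
composite of any two composable arrows. A loop with nonzero value would then give infinitely many
values of `D`, against finite support; so `D` vanishes on loops and depends only on endpoints. With
a base point chosen over each place of `k`, the value of `D` on an arrow from the base point to `B`
defines `E B`. Over ramified places everything is zero. -/

namespace EtaleDivisor

/-! ### Places as subsets of the algebra; functoriality of places and divisors -/

section Place

variable {k : Type*} [Field k]
variable {F : Type*} [CommRing F] [Algebra k F]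
variable {F' : Type*} [CommRing F'] [Algebra k F']
variable {F'' : Type*} [CommRing F''] [Algebra k F'']

/-- The projection of `F` onto one of its factors. -/
def toFactor (k : Type*) [Field k] {F : Type*} [CommRing F] [Algebra k F] (𝔪 : MaximalSpectrum F) :
    F →ₐ[k] Factor 𝔪 :=
  Ideal.Quotient.mkₐ k 𝔪.asIdeal

theorem toFactor_surjective (𝔪 : MaximalSpectrum F) : Function.Surjective (toFactor k 𝔪) :=
  Ideal.Quotient.mk_surjective

theorem toFactor_eq_zero_iff {𝔪 : MaximalSpectrum F} {x : F} :
    toFactor k 𝔪 x = 0 ↔ x ∈ 𝔪.asIdeal :=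
  Ideal.Quotient.eq_zero_iff_mem

/-- The elements of `F` whose image in the factor of the place `Q` is integral and vanishes
at `Q`. -/
def Place.vanishing (k : Type*) [Field k] {F : Type*} [CommRing F] [Algebra k F] (Q : Place F) :
    Set F :=
  {x | ∃ y ∈ Q.2.asIdeal, (y : Factor Q.1) = toFactor k Q.1 x}

theorem Place.mem_asIdeal_iff (Q : Place F) (x : F) :
    x ∈ Q.1.asIdeal ↔ ∀ a, a * x ∈ Q.vanishing k := by
  constructor
  · intro hx a
    refine ⟨0, zero_mem _, ?_⟩
    have : toFactor k Q.1 (a * x) = 0 := toFactor_eq_zero_iff.2 (Ideal.mul_mem_left _ _ hx)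
    rw [this]; rfl
  · intro h
    by_contra hx
    have h0 : toFactor k Q.1 x ≠ 0 := fun h => hx (toFactor_eq_zero_iff.1 h)
    obtain ⟨a, ha⟩ := toFactor_surjective (k := k) Q.1 (toFactor k Q.1 x)⁻¹
    obtain ⟨y, hy, hyx⟩ := h a
    rw [map_mul, ha, inv_mul_cancel₀ h0] at hyx
    have : y = 1 := NumberField.RingOfIntegers.ext hyx
    exact Q.2.isPrime.ne_top ((Ideal.eq_top_iff_one _).2 (this ▸ hy))

/-- Equality in the sigma type `Place F` becomes equality of subsets of `F`, which avoids transport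
between factors. The set recovers the maximal ideal as the largest ideal it contains, then the
prime. -/
theorem Place.ext_vanishing {Q Q' : Place F} (h : Q.vanishing k = Q'.vanishing k) : Q = Q' := by
  obtain ⟨m, q⟩ := Q
  obtain ⟨m', q'⟩ := Q'
  have hm : m = m' := by
    ext x
    rw [Place.mem_asIdeal_iff (k := k) ⟨m, q⟩, Place.mem_asIdeal_iff (k := k) ⟨m', q'⟩, h]
  subst hm
  congr 1
  ext y
  obtain ⟨x, hx⟩ := toFactor_surjective (k := k) m y
  have key : ∀ r : HeightOneSpectrum (𝓞 (Factor m)),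
      y ∈ r.asIdeal ↔ x ∈ Place.vanishing k (⟨m, r⟩ : Place F) := by
    intro r
    refine ⟨fun hy => ⟨y, hy, hx.symm⟩, ?_⟩
    rintro ⟨z, hz, hzx⟩
    have : z = y := NumberField.RingOfIntegers.ext (hzx.trans hx)
    exact this ▸ hz
  rw [key, key, h]

variable [Module.Finite k F]

theorem component_comp [Module.Finite k F'] (f : F →ₐ[k] F') (g : F' →ₐ[k] F'')
    (𝔪 : MaximalSpectrum F'') (x : Factor (comapFactor f (comapFactor g 𝔪))) :
    component (g.comp f) 𝔪 x = component g 𝔪 (component f (comapFactor g 𝔪) x) := by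
  obtain ⟨a, rfl⟩ := toFactor_surjective (k := k) _ x
  rfl

theorem mem_vanishing_below (f : F →ₐ[k] F') (Q : Place F') (x : F) :
    x ∈ (below f Q).vanishing k ↔ f x ∈ Q.vanishing k := by
  constructor
  · rintro ⟨y, hy, hyx⟩
    exact ⟨integerComponent f Q.1 y, hy, congrArg (component f Q.1) hyx⟩
  · rintro ⟨y, hy, hyx⟩
    -- Integrality over `ℤ` is reflected by the field embedding `component f Q.1`.
    have hint : IsIntegral ℤ (toFactor k (comapFactor f Q.1) x) := by
      rw [← isIntegral_algHom_iff (component f Q.1).toIntAlgHom (component f Q.1).injective]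
      change IsIntegral ℤ (toFactor k Q.1 (f x))
      rw [← hyx]
      exact y.2
    refine ⟨⟨_, hint⟩, ?_, rfl⟩
    change integerComponent f Q.1 ⟨_, hint⟩ ∈ Q.2.asIdeal
    have : integerComponent f Q.1 ⟨_, hint⟩ = y :=
      NumberField.RingOfIntegers.ext hyx.symm
    rwa [this]

theorem below_eq_of_forall {f : F →ₐ[k] F'} {Q : Place F'} {P : Place F}
    (h : ∀ x, x ∈ P.vanishing k ↔ f x ∈ Q.vanishing k) : below f Q = P :=
  Place.ext_vanishing (k := k) (Set.ext fun x => (mem_vanishing_below f Q x).trans (h x).symm)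

theorem below_comp [Module.Finite k F'] (f : F →ₐ[k] F') (g : F' →ₐ[k] F'') (Q : Place F'') :
    below (g.comp f) Q = below f (below g Q) :=
  below_eq_of_forall fun x =>
    (mem_vanishing_below f (below g Q) x).trans (mem_vanishing_below g Q (f x))

theorem ramIdx_comp [NumberField k] [Module.Finite k F'] [Module.Finite k F'']
    (f : F →ₐ[k] F') (g : F' →ₐ[k] F'') (Q : Place F'') :
    ramIdx (g.comp f) Q = ramIdx f (below g Q) * ramIdx g Q := by
  have := numberField_factor k Q.1
  have := numberField_factor k (comapFactor g Q.1)
  have := numberField_factor k (comapFactor f (comapFactor g Q.1))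
  let i1 : Algebra (𝓞 (Factor (comapFactor g Q.1))) (𝓞 (Factor Q.1)) :=
    (integerComponent g Q.1).toAlgebra
  let i2 : Algebra (𝓞 (Factor (comapFactor f (comapFactor g Q.1))))
      (𝓞 (Factor (comapFactor g Q.1))) :=
    (integerComponent f (comapFactor g Q.1)).toAlgebra
  let i3 : Algebra (𝓞 (Factor (comapFactor f (comapFactor g Q.1)))) (𝓞 (Factor Q.1)) :=
    (integerComponent (g.comp f) Q.1).toAlgebra
  have : IsScalarTower (𝓞 (Factor (comapFactor f (comapFactor g Q.1))))
      (𝓞 (Factor (comapFactor g Q.1))) (𝓞 (Factor Q.1)) := 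
    .of_algebraMap_eq' (RingHom.ext fun x =>
      NumberField.RingOfIntegers.ext (component_comp f g Q.1 x))
  let q : Ideal (𝓞 (Factor (comapFactor g Q.1))) := (below g Q).2.asIdeal
  have : Q.2.asIdeal.LiesOver q := ⟨rfl⟩
  have : FaithfulSMul (𝓞 (Factor (comapFactor g Q.1))) (𝓞 (Factor Q.1)) := by
    rw [faithfulSMul_iff_algebraMap_injective]
    intro x y hxy
    exact NumberField.RingOfIntegers.ext
      ((component g Q.1).injective (congrArg (fun z : 𝓞 (Factor Q.1) => (z : Factor Q.1)) hxy))
  have key : Q.2.asIdeal.ramificationIdx (𝓞 (Factor (comapFactor f (comapFactor g Q.1)))) =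
      q.ramificationIdx (𝓞 (Factor (comapFactor f (comapFactor g Q.1)))) *
        Q.2.asIdeal.ramificationIdx (𝓞 (Factor (comapFactor g Q.1))) :=
    Ideal.ramificationIdx_tower q Q.2.asIdeal
  exact key

theorem divMap_apply [NumberField k] [Module.Finite k F'] (f : F →ₐ[k] F') (D : Divisor F)
    (Q : Place F') :
    divMap f D Q = ramIdx f Q * D (below f Q) := by
  classical
  have h : ∀ P : Place F, (∑ R ∈ (finite_above f P).toFinset,
      Finsupp.single R (ramIdx f R : ℤ)) Q = if P = below f Q then (ramIdx f Q : ℤ) else 0 := by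
    intro P
    rw [Finsupp.finsetSum_apply]
    simp only [Finsupp.single_apply, Finset.sum_ite_eq', Set.Finite.mem_toFinset]
    exact if_congr eq_comm rfl rfl
  rw [divMap, Finsupp.liftAddHom_apply, Finsupp.sum_apply, Finsupp.sum]
  simp only [zmultiplesHom_apply, Finsupp.smul_apply, h, smul_eq_mul, mul_ite, mul_zero,
    Finset.sum_ite_eq', Finsupp.mem_support_iff]
  split_ifs with h0
  · ring
  · rw [not_not.1 h0, mul_zero]

end Place
end EtaleDivisor

/-! ### Ramification and inertia in Galois extensions of number fields -/

theorem Ideal.card_inertia_eq_ramificationIdx {K N : Type*} [Field K] [NumberField K] [Field N]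
    [NumberField N] [Algebra K N] [IsGalois K N] (Q : Ideal (𝓞 N)) [Q.IsPrime] :
    Nat.card (Q.inertia Gal(N/K)) = Q.ramificationIdx (𝓞 K) := by
  rw [Ideal.card_inertia_eq_ramificationIdxIn (Q.under (𝓞 K)) Q,
    Ideal.ramificationIdxIn_eq_ramificationIdx (Q.under (𝓞 K)) Q Gal(N/K)]

/-- By multiplicativity in towers, the index of `q` is the quotient of the orders of the inertia
groups over `K` and over `L`. The second embeds in the first, and the embedding is onto exactly when
inertia over `K` fixes `L`. -/
theorem Ideal.ramificationIdx_eq_one_iff_inertia {K L N : Type*} [Field K] [NumberField K] [Field L]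
    [NumberField L] [Field N] [NumberField N] [Algebra K L] [Algebra L N] [Algebra K N]
    [IsScalarTower K L N] [IsGalois K N] (Q : Ideal (𝓞 N)) [Q.IsPrime] (q : Ideal (𝓞 L))
    [Q.LiesOver q] :
    q.ramificationIdx (𝓞 K) = 1 ↔
      ∀ σ ∈ Q.inertia Gal(N/K), ∀ x : L, σ (algebraMap L N x) = algebraMap L N x := by
  have : IsGalois L N := IsGalois.tower_top_of_isGalois K L N
  have hq : q.IsPrime := Ideal.isPrime_of_liesOver Q q
  have htower := Ideal.ramificationIdx_tower (R := 𝓞 K) q Q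
  rw [← card_inertia_eq_ramificationIdx Q, ← card_inertia_eq_ramificationIdx Q] at htower
  have hpos : 0 < Nat.card (Q.inertia Gal(N/L)) := Nat.card_pos
  have hinj : Function.Injective (AlgEquiv.restrictScalars K : Gal(N/L) → Gal(N/K)) :=
    AlgEquiv.restrictScalars_injective K
  have hmem : ∀ σ : Gal(N/L), σ ∈ Q.inertia Gal(N/L) ↔
      σ.restrictScalars K ∈ Q.inertia Gal(N/K) := fun σ => Iff.rfl
  let φ : Q.inertia Gal(N/L) → Q.inertia Gal(N/K) := fun σ =>
    ⟨σ.1.restrictScalars K, (hmem _).1 σ.2⟩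
  have hφ : Function.Injective φ := fun σ τ h => Subtype.ext (hinj (congrArg Subtype.val h))
  constructor
  · intro h σ hσ x
    rw [h, one_mul] at htower
    have hbij : Function.Bijective φ := (Nat.bijective_iff_injective_and_card φ).2 ⟨hφ, htower.symm⟩
    obtain ⟨τ, hτ⟩ := hbij.2 ⟨σ, hσ⟩
    have : σ = τ.1.restrictScalars K := (congrArg Subtype.val hτ).symm
    rw [this]
    exact τ.1.commutes x
  · intro h
    have hsurj : Function.Surjective φ := fun σ =>
      ⟨⟨AlgEquiv.ofRingEquiv (f := σ.1.toRingEquiv) (h σ.1 σ.2), (hmem _).2 σ.2⟩, rfl⟩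
    rw [← Nat.card_congr (Equiv.ofBijective φ ⟨hφ, hsurj⟩)] at htower
    exact Nat.eq_of_mul_eq_mul_right hpos (by rw [one_mul, ← htower])

/-- Two finite extensions of a perfect field embed into a common finite Galois extension. -/
theorem IsGalois.exists_algHom_algHom (K L₁ L₂ : Type*) [Field K] [PerfectField K] [Field L₁]
    [Field L₂] [Algebra K L₁] [Algebra K L₂] [Module.Finite K L₁] [Module.Finite K L₂] :
    ∃ N : IntermediateField K (AlgebraicClosure K), FiniteDimensional K N ∧ IsGalois K N ∧
      Nonempty (L₁ →ₐ[K] N) ∧ Nonempty (L₂ →ₐ[K] N) := by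
  let ψ₁ : L₁ →ₐ[K] AlgebraicClosure K := IsAlgClosed.lift
  let ψ₂ : L₂ →ₐ[K] AlgebraicClosure K := IsAlgClosed.lift
  let E : IntermediateField K (AlgebraicClosure K) := ψ₁.fieldRange ⊔ ψ₂.fieldRange
  have : FiniteDimensional K ψ₁.fieldRange := ψ₁.toLinearMap.finiteDimensional_range
  have : FiniteDimensional K ψ₂.fieldRange := ψ₂.toLinearMap.finiteDimensional_range
  have hE : E ≤ IntermediateField.normalClosure K E (AlgebraicClosure K) := E.le_normalClosure
  refine ⟨IntermediateField.normalClosure K E (AlgebraicClosure K), inferInstance, ?_,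
    ⟨ψ₁.codRestrict _ fun x => hE (le_sup_left (α := IntermediateField K _) ⟨x, rfl⟩)⟩,
    ⟨ψ₂.codRestrict _ fun x => hE (le_sup_right (α := IntermediateField K _) ⟨x, rfl⟩)⟩⟩
  exact ⟨⟩

namespace EtaleDivisor

/-! ### Places above a given place -/

section Above

variable {k : Type*} [Field k]
variable {T : Type*} [CommRing T] [Algebra k T] [Module.Finite k T]
variable {N : Type*} [Field N] [Algebra k N]

theorem toFactor_bijective (𝔪 : MaximalSpectrum N) : Function.Bijective (toFactor k 𝔪) :=
  ⟨(toFactor k 𝔪).toRingHom.injective, toFactor_surjective 𝔪⟩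

/-- A field, as a vector space over a subfield, is isomorphic to its only factor. -/
noncomputable def equivFactor (k : Type*) [Field k] {N : Type*} [Field N] [Algebra k N]
    (𝔪 : MaximalSpectrum N) : N ≃ₐ[k] Factor 𝔪 :=
  AlgEquiv.ofBijective (toFactor k 𝔪) (toFactor_bijective 𝔪)

theorem mem_asIdeal_iff_mem_vanishing_below {T' : Type*} [CommRing T'] [Algebra k T']
    (f : T →ₐ[k] T') (W : Place T') {s : T} {z : 𝓞 (Factor W.1)}
    (h : (z : Factor W.1) = toFactor k W.1 (f s)) :
    z ∈ W.2.asIdeal ↔ s ∈ (below f W).vanishing k := by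
  rw [mem_vanishing_below]
  refine ⟨fun hz => ⟨z, hz, h⟩, ?_⟩
  rintro ⟨y, hy, hys⟩
  have : y = z := NumberField.RingOfIntegers.ext (hys.trans h.symm)
  exact this ▸ hy

theorem exists_below_eq {T' : Type*} [CommRing T'] [Algebra k T'] (f : T →ₐ[k] T') (Q : Place T)
    (𝔪 : MaximalSpectrum T') (h : comapFactor f 𝔪 = Q.1) :
    ∃ q : HeightOneSpectrum (𝓞 (Factor 𝔪)), below f ⟨𝔪, q⟩ = Q := by
  obtain ⟨m, p⟩ := Q
  subst h
  let := (integerComponent f 𝔪).toAlgebra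
  have : Algebra.IsIntegral (𝓞 (Factor (comapFactor f 𝔪))) (𝓞 (Factor 𝔪)) :=
    ⟨integerComponent_isIntegral f 𝔪⟩
  have : FaithfulSMul (𝓞 (Factor (comapFactor f 𝔪))) (𝓞 (Factor 𝔪)) := by
    rw [faithfulSMul_iff_algebraMap_injective]
    intro x y hxy
    exact NumberField.RingOfIntegers.ext
      ((component f 𝔪).injective (congrArg (fun z : 𝓞 (Factor 𝔪) => (z : Factor 𝔪)) hxy))
  have := p.isPrime
  obtain ⟨q, hq, hqp⟩ := (inferInstance : Nonempty (p.asIdeal.primesOver (𝓞 (Factor 𝔪))))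
  refine ⟨⟨q, hq, ?_⟩, ?_⟩
  · rintro rfl
    refine p.ne_bot (hqp.over.trans ?_)
    rw [Ideal.under_bot]
  · exact Sigma.ext rfl (heq_of_eq (HeightOneSpectrum.ext hqp.over.symm))

theorem comapFactor_eq_of_ker {f : T →ₐ[k] N} {m : MaximalSpectrum T}
    (h : ∀ x ∈ m.asIdeal, f x = 0) (𝔪 : MaximalSpectrum N) : comapFactor f 𝔪 = m := by
  refine MaximalSpectrum.ext (m.isMaximal.eq_of_le (comapFactor f 𝔪).isMaximal.ne_top ?_).symm
  intro x hx
  change f x ∈ 𝔪.asIdeal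
  rw [h x hx]
  exact zero_mem _

end Above

/-! ### Amalgamating two places over a common one -/

section Lift

variable {k : Type*} [Field k] [NumberField k]

/-- Two places with the same image in `S` are induced by a single place of a common extension. -/
theorem exists_common_place.{u} {S : Type u} [CommRing S] [Algebra k S] [Module.Finite k S]
    {T₁ T₂ : Type*} [CommRing T₁] [Algebra k T₁] [Module.Finite k T₁] [CommRing T₂] [Algebra k T₂]
    [Module.Finite k T₂] (f₁ : S →ₐ[k] T₁) (f₂ : S →ₐ[k] T₂) (Q₁ : Place T₁) (Q₂ : Place T₂)
    (h : below f₁ Q₁ = below f₂ Q₂) :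
    ∃ (N : Type u) (_ : Field N) (_ : Algebra k N) (χ₁ : T₁ →ₐ[k] N) (χ₂ : T₂ →ₐ[k] N)
      (W : Place N), χ₁.comp f₁ = χ₂.comp f₂ ∧ below χ₁ W = Q₁ ∧ below χ₂ W = Q₂ := by
  obtain ⟨m, hm⟩ : ∃ m, m = (below f₁ Q₁).1 := ⟨_, rfl⟩
  have hm' : m = (below f₂ Q₂).1 := h ▸ hm
  obtain ⟨m₁, p₁⟩ := Q₁
  obtain ⟨m₂, p₂⟩ := Q₂
  have := numberField_factor k m
  have := numberField_factor k m₁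
  have := numberField_factor k m₂
  have h1 : ∀ s ∈ m.asIdeal, AlgHom.comp (toFactor k m₁) f₁ s = 0 := by
    intro s hs; rw [hm] at hs
    exact (toFactor_eq_zero_iff (k := k)).2 hs
  have h2 : ∀ s ∈ m.asIdeal, AlgHom.comp (toFactor k m₂) f₂ s = 0 := by
    intro s hs; rw [hm'] at hs
    exact (toFactor_eq_zero_iff (k := k)).2 hs
  let ψ₁ : Factor m →ₐ[k] Factor m₁ := Ideal.Quotient.liftₐ m.asIdeal _ h1
  let ψ₂ : Factor m →ₐ[k] Factor m₂ := Ideal.Quotient.liftₐ m.asIdeal _ h2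
  let : Algebra (Factor m) (Factor m₁) := ψ₁.toRingHom.toAlgebra
  let : Algebra (Factor m) (Factor m₂) := ψ₂.toRingHom.toAlgebra
  have : IsScalarTower k (Factor m) (Factor m₁) := .of_algebraMap_eq' ψ₁.comp_algebraMap.symm
  have : IsScalarTower k (Factor m) (Factor m₂) := .of_algebraMap_eq' ψ₂.comp_algebraMap.symm
  have : Module.Finite (Factor m) (Factor m₁) :=
    Module.Finite.of_restrictScalars_finite k _ _
  have : Module.Finite (Factor m) (Factor m₂) :=
    Module.Finite.of_restrictScalars_finite k _ _
  obtain ⟨N, hfin, hgal, ⟨φ₁⟩, ⟨φ₂⟩⟩ :=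
    IsGalois.exists_algHom_algHom (Factor m) (Factor m₁) (Factor m₂)
  let χ₁ : T₁ →ₐ[k] N := (φ₁.restrictScalars k).comp (toFactor k m₁)
  let χ₂ : T₂ →ₐ[k] N := (φ₂.restrictScalars k).comp (toFactor k m₂)
  have hχ₁ : ∀ s, χ₁ (f₁ s) = algebraMap (Factor m) N (toFactor k m s) :=
    fun s => φ₁.commutes (toFactor k m s)
  have hχ₂ : ∀ s, χ₂ (f₂ s) = algebraMap (Factor m) N (toFactor k m s) :=
    fun s => φ₂.commutes (toFactor k m s)
  obtain ⟨𝔬⟩ : Nonempty (MaximalSpectrum N) := inferInstance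
  obtain ⟨q₁, hq₁⟩ := exists_below_eq χ₁ ⟨m₁, p₁⟩ 𝔬 (comapFactor_eq_of_ker (fun x hx => by
    change φ₁ (toFactor k m₁ x) = 0
    rw [toFactor_eq_zero_iff.2 hx, map_zero]) 𝔬)
  obtain ⟨q₂, hq₂⟩ := exists_below_eq χ₂ ⟨m₂, p₂⟩ 𝔬 (comapFactor_eq_of_ker (fun x hx => by
    change φ₂ (toFactor k m₂ x) = 0
    rw [toFactor_eq_zero_iff.2 hx, map_zero]) 𝔬)
  have : NumberField N := NumberField.of_module_finite (Factor m) N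
  have := numberField_factor (Factor m) 𝔬
  let e := equivFactor (Factor m) 𝔬
  have : IsGalois (Factor m) (Factor 𝔬) := IsGalois.of_algEquiv e
  -- Both primes contract to the prime of the common place in `S`, so the Galois group of `N` over
  -- the factor of `S` moves one to the other.
  have hover : q₁.asIdeal.under (𝓞 (Factor m)) = q₂.asIdeal.under (𝓞 (Factor m)) := by
    ext y
    obtain ⟨s, hs⟩ := toFactor_surjective (k := k) m (y : Factor m)
    have e1 : ((algebraMap (𝓞 (Factor m)) (𝓞 (Factor 𝔬)) y : 𝓞 (Factor 𝔬)) : Factor 𝔬) =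
        toFactor k 𝔬 ((χ₁.comp f₁) s) := by
      rw [AlgHom.comp_apply, hχ₁, hs]; rfl
    have e2 : ((algebraMap (𝓞 (Factor m)) (𝓞 (Factor 𝔬)) y : 𝓞 (Factor 𝔬)) : Factor 𝔬) =
        toFactor k 𝔬 ((χ₂.comp f₂) s) := by
      rw [AlgHom.comp_apply, hχ₂, hs]; rfl
    have b₁ : below (χ₁.comp f₁) (⟨𝔬, q₁⟩ : Place N) = below f₁ ⟨m₁, p₁⟩ :=
      (below_comp f₁ χ₁ _).trans (congrArg (below f₁) hq₁)
    have b₂ : below (χ₂.comp f₂) (⟨𝔬, q₂⟩ : Place N) = below f₂ ⟨m₂, p₂⟩ :=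
      (below_comp f₂ χ₂ _).trans (congrArg (below f₂) hq₂)
    have b := congrArg (s ∈ Place.vanishing k ·) (b₁.trans (h.trans b₂.symm))
    exact (mem_asIdeal_iff_mem_vanishing_below (χ₁.comp f₁) (⟨𝔬, q₁⟩ : Place N) e1).trans
      ((Iff.of_eq b).trans
        (mem_asIdeal_iff_mem_vanishing_below (χ₂.comp f₂) (⟨𝔬, q₂⟩ : Place N) e2).symm)
  have := q₁.isPrime
  have := q₂.isPrime
  have : q₂.asIdeal.LiesOver (q₁.asIdeal.under (𝓞 (Factor m))) := ⟨hover⟩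
  obtain ⟨σ, hσ⟩ := Ideal.exists_smul_eq_of_isGaloisGroup
    (q₁.asIdeal.under (𝓞 (Factor m))) q₁.asIdeal q₂.asIdeal Gal(Factor 𝔬/Factor m)
  -- As `σ` carries `q₁` to `q₂`, twisting `χ₂` by the inverse of `σ` makes `q₁` induce `Q₂`; the
  -- twist fixes the factor of `S`, so the square still commutes.
  let τ : N →ₐ[Factor m] N := ((e.trans σ.symm).trans e.symm : N ≃ₐ[Factor m] N)
  have hτ : ∀ x, toFactor k 𝔬 (τ x) = σ.symm (toFactor k 𝔬 x) := fun x => e.apply_symm_apply _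
  refine ⟨N, inferInstance, inferInstance, χ₁, (τ.restrictScalars k).comp χ₂, ⟨𝔬, q₁⟩, ?_, hq₁, ?_⟩
  · refine AlgHom.ext fun s => ?_
    change χ₁ (f₁ s) = τ (χ₂ (f₂ s))
    rw [hχ₁, hχ₂, τ.commutes]
  · refine below_eq_of_forall fun x => ?_
    rw [← hq₂]
    refine (mem_vanishing_below χ₂ (⟨𝔬, q₂⟩ : Place N) x).trans ?_
    change (∃ y ∈ q₂.asIdeal, (y : Factor 𝔬) = toFactor k 𝔬 (χ₂ x)) ↔
      ∃ y ∈ q₁.asIdeal, (y : Factor 𝔬) = toFactor k 𝔬 (τ (χ₂ x))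
    rw [hτ, ← hσ]
    constructor
    · rintro ⟨y, hy, hyx⟩
      refine ⟨σ⁻¹ • y, Ideal.mem_pointwise_smul_iff_inv_smul_mem.1 hy, ?_⟩
      rw [← hyx]; rfl
    · rintro ⟨y, hy, hyx⟩
      refine ⟨σ • y, Ideal.smul_mem_pointwise_smul _ _ _ hy, ?_⟩
      have : σ (y : Factor 𝔬) = toFactor k 𝔬 (χ₂ x) := by rw [hyx]; exact σ.apply_symm_apply _
      exact this

end Lift

/-! ### Unramified places of tensor products -/

section Unramified

variable {k : Type*} [Field k] [NumberField k]
variable {T : Type*} [CommRing T] [Algebra k T] [Module.Finite k T]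
variable {N : Type*} [CommRing N] [Algebra k N] [Module.Finite k N]

theorem ramIdx_below_eq_one_iff (f : T →ₐ[k] N) (W : Place N) [IsGalois k (Factor W.1)] :
    ramIdx (Algebra.ofId k T) (below f W) = 1 ↔
      ∀ σ : Gal(Factor W.1/k), (∀ y : 𝓞 (Factor W.1), σ • y - y ∈ W.2.asIdeal) →
        ∀ x : T, σ (toFactor k W.1 (f x)) = toFactor k W.1 (f x) := by
  let L := Factor (comapFactor f W.1)
  let K := Factor (comapFactor (Algebra.ofId k T) (comapFactor f W.1))
  have : NumberField (Factor W.1) := numberField_factor k _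
  have : NumberField L := numberField_factor k _
  have : NumberField K := numberField_factor k _
  let : Algebra K L := (component (Algebra.ofId k T) (comapFactor f W.1)).toAlgebra
  let : Algebra L (Factor W.1) := (component f W.1).toAlgebra
  let : Algebra K (Factor W.1) :=
    ((component f W.1).comp (component (Algebra.ofId k T) (comapFactor f W.1))).toAlgebra
  have : IsScalarTower K L (Factor W.1) := .of_algebraMap_eq' rfl
  -- `K` is the image of `k`, so automorphisms over `K` and over `k` are the same.
  have hK : ∀ a : k, algebraMap K (Factor W.1) (toFactor k _ a) = algebraMap k (Factor W.1) a := by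
    intro a
    exact (toFactor k W.1).commutes a ▸ congrArg (toFactor k W.1) (f.commutes a)
  have : IsScalarTower k K (Factor W.1) := .of_algebraMap_eq fun a => (hK a).symm
  have : IsGalois K (Factor W.1) := IsGalois.tower_top_of_isGalois k K (Factor W.1)
  have := W.2.isPrime
  let q : Ideal (𝓞 L) := (below f W).2.asIdeal
  have : W.2.asIdeal.LiesOver q := ⟨rfl⟩
  have key := Ideal.ramificationIdx_eq_one_iff_inertia (K := K) W.2.asIdeal q
  refine Iff.trans (Iff.of_eq rfl) (key.trans ⟨fun H σ hσ x => ?_, fun H σ hσ x => ?_⟩)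
  · let σ' : Gal(Factor W.1/K) := AlgEquiv.ofRingEquiv (f := σ.toRingEquiv) (by
      intro a
      obtain ⟨b, rfl⟩ := toFactor_surjective (k := k) _ a
      rw [hK]
      exact σ.commutes b)
    exact H σ' hσ (toFactor k _ x)
  · obtain ⟨a, rfl⟩ := toFactor_surjective (k := k) _ x
    exact H (σ.restrictScalars k) hσ a

theorem exists_isGalois_below_eq.{u} {k : Type u} [Field k] [NumberField k] {T : Type*} [CommRing T]
    [Algebra k T] [Module.Finite k T] (Q : Place T) :
    ∃ (N : Type u) (_ : CommRing N) (_ : Algebra k N) (_ : Module.Finite k N)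
      (f : T →ₐ[k] N) (W : Place N), IsGalois k (Factor W.1) ∧ below f W = Q := by
  obtain ⟨m, p⟩ := Q
  obtain ⟨N, hfin, hgal, ⟨φ⟩, -⟩ := IsGalois.exists_algHom_algHom k (Factor m) (Factor m)
  obtain ⟨𝔬⟩ : Nonempty (MaximalSpectrum N) := inferInstance
  obtain ⟨q, hq⟩ := exists_below_eq (φ.comp (toFactor k m)) ⟨m, p⟩ 𝔬
    (comapFactor_eq_of_ker (fun x hx => by
      rw [AlgHom.comp_apply, toFactor_eq_zero_iff.2 hx, map_zero]) 𝔬)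
  exact ⟨N, inferInstance, inferInstance, inferInstance, φ.comp (toFactor k m), ⟨𝔬, q⟩,
    IsGalois.of_algEquiv (equivFactor k 𝔬), hq⟩

/-- In a Galois extension above `Q`, inertia fixes the images of `T₁` and `T₂`, which generate that
of `T₁ ⊗ T₂`. -/
theorem ramIdx_tensorProduct_eq_one {T₁ T₂ : Type*} [CommRing T₁] [Algebra k T₁]
    [Module.Finite k T₁] [CommRing T₂] [Algebra k T₂] [Module.Finite k T₂]
    (Q : Place (T₁ ⊗[k] T₂))
    (h₁ : ramIdx (Algebra.ofId k T₁) 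
      (below (Algebra.TensorProduct.includeLeft : T₁ →ₐ[k] T₁ ⊗[k] T₂) Q) = 1)
    (h₂ : ramIdx (Algebra.ofId k T₂) 
      (below (Algebra.TensorProduct.includeRight : T₂ →ₐ[k] T₁ ⊗[k] T₂) Q) = 1) :
    ramIdx (Algebra.ofId k (T₁ ⊗[k] T₂)) Q = 1 := by
  obtain ⟨N, _, _, _, f, W, _, rfl⟩ := exists_isGalois_below_eq (k := k) Q
  rw [← below_comp, ramIdx_below_eq_one_iff] at h₁ h₂
  rw [ramIdx_below_eq_one_iff]
  intro σ hσ x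
  have : ((σ : Factor W.1 →ₐ[k] Factor W.1).comp (toFactor k W.1)).comp f =
      (toFactor k W.1).comp f := by
    ext x
    · exact h₁ σ hσ x
    · exact h₂ σ hσ x
  exact DFunLike.congr_fun this x

end Unramified
end EtaleDivisor

namespace EtaleDivisor

/-! ### Faces and ramification in the Amitsur complex -/

section Amitsur

variable {k : Type*} [Field k]

theorem below_ofId_below {T T' : Type*} [CommRing T] [Algebra k T] [Module.Finite k T] [CommRing T']
    [Algebra k T'] (f : T →ₐ[k] T') (Q : Place T') :
    below (Algebra.ofId k T) (below f Q) = below (Algebra.ofId k T') Q := by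
  rw [← below_comp]
  congr 1
  exact Subsingleton.elim _ _

theorem ramIdx_ofId_eq_one {F : Type*} [CommRing F] [Algebra k F] [Module.Finite k F]
    {T : Type*} [CommRing T] [Algebra k T] (f : F →ₐ[k] T) (Q : Place T)
    (h : ¬ Ramifies (Algebra.ofId k F) (below (Algebra.ofId k T) Q)) :
    ramIdx (Algebra.ofId k F) (below f Q) = 1 := by
  by_contra hne
  exact h ⟨below f Q, below_ofId_below f Q, hne⟩

section Faces

variable {F : Type*} [CommRing F] [Algebra k F]

theorem eps11_comp_eps01 : (eps11 k F).comp (eps01 k F) = (eps12 k F).comp (eps01 k F) := by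
  ext x
  simp [eps11, eps12, eps01]

theorem eps11_comp_eps00 : (eps11 k F).comp (eps00 k F) = (eps10 k F).comp (eps00 k F) := by
  ext x
  simp [eps11, eps10, eps00]

end Faces

variable [NumberField k]

theorem ramIdx_eq_one_of_ofId {T T' : Type*} [CommRing T] [Algebra k T] [Module.Finite k T]
    [CommRing T'] [Algebra k T'] [Module.Finite k T'] (f : T →ₐ[k] T') {Q : Place T'}
    (h : ramIdx (Algebra.ofId k T') Q = 1) : ramIdx f Q = 1 := by
  rw [show Algebra.ofId k T' = f.comp (Algebra.ofId k T) from Subsingleton.elim _ _,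
    ramIdx_comp] at h
  exact Nat.eq_one_of_mul_eq_one_left h

variable {F : Type*} [CommRing F] [Algebra k F] [Module.Finite k F]

theorem ramIdx_ofId_tensor_eq_one (Q : Place (F ⊗[k] F))
    (h : ¬ Ramifies (Algebra.ofId k F) (below (Algebra.ofId k (F ⊗[k] F)) Q)) :
    ramIdx (Algebra.ofId k (F ⊗[k] F)) Q = 1 :=
  ramIdx_tensorProduct_eq_one Q (ramIdx_ofId_eq_one _ Q h) (ramIdx_ofId_eq_one _ Q h)

theorem ramIdx_ofId_tensor_tensor_eq_one (R : Place (F ⊗[k] (F ⊗[k] F)))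
    (h : ¬ Ramifies (Algebra.ofId k F) (below (Algebra.ofId k (F ⊗[k] (F ⊗[k] F))) R)) :
    ramIdx (Algebra.ofId k (F ⊗[k] (F ⊗[k] F))) R = 1 :=
  ramIdx_tensorProduct_eq_one R (ramIdx_ofId_eq_one _ R h)
    (ramIdx_ofId_tensor_eq_one _ (by rwa [below_ofId_below]))

/-- Two places of `F` above the same place of `k` are the two projections of a place of `F ⊗ F`. -/
theorem exists_place_tensor (A B : Place F)
    (h : below (Algebra.ofId k F) A = below (Algebra.ofId k F) B) :
    ∃ Q : Place (F ⊗[k] F), below (eps01 k F) Q = A ∧ below (eps00 k F) Q = B := by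
  obtain ⟨N, _, _, χ₁, χ₂, W, -, rfl, rfl⟩ := exists_common_place _ _ A B h
  refine ⟨below (Algebra.TensorProduct.lift χ₁ χ₂ fun _ _ => Commute.all _ _) W, ?_, ?_⟩
  · rw [← below_comp]
    congr 1
    exact Algebra.TensorProduct.lift_comp_includeLeft χ₁ χ₂ fun _ _ => Commute.all _ _
  · rw [← below_comp]
    congr 1
    exact Algebra.TensorProduct.lift_comp_includeRight χ₁ χ₂ fun _ _ => Commute.all _ _

/-- Composable places of `F ⊗ F` are the outer faces of a place of `F ⊗ F ⊗ F`. -/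
theorem exists_place_tensor_tensor (Q Q' : Place (F ⊗[k] F))
    (h : below (eps00 k F) Q = below (eps01 k F) Q') :
    ∃ R : Place (F ⊗[k] (F ⊗[k] F)), below (eps12 k F) R = Q ∧ below (eps10 k F) R = Q' := by
  obtain ⟨N, _, _, χ₁, χ₂, W, hχ, rfl, rfl⟩ := exists_common_place _ _ Q Q' h
  refine ⟨below (Algebra.TensorProduct.lift (χ₁.comp (eps01 k F)) χ₂
    fun _ _ => Commute.all _ _) W, ?_, ?_⟩
  · rw [← below_comp]
    congr 1
    ext x
    · simp [eps12, eps01, ← Algebra.TensorProduct.one_def]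
    · simpa [eps12, eps01, eps00, ← Algebra.TensorProduct.one_def] using
        (DFunLike.congr_fun hχ x).symm
  · rw [← below_comp]
    congr 1
    exact Algebra.TensorProduct.lift_comp_includeRight (χ₁.comp (eps01 k F)) χ₂
      fun _ _ => Commute.all _ _

/-! ### Cocycles as additive functions on arrows -/

section Cocycle

variable {D : Divisor (F ⊗[k] F)} (hD : D ∈ (divDelta1 k F).ker)

include hD

/-- The middle face of a place of `F ⊗ F ⊗ F` with outer faces `Q` and `Q'` is a composite; with all
indices 1, the cocycle condition there is additivity. Composites need not be unique, so only
existence is claimed. -/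
theorem exists_comp_place {Q Q' : Place (F ⊗[k] F)}
    (hQ : ¬ Ramifies (Algebra.ofId k F) (below (Algebra.ofId k (F ⊗[k] F)) Q))
    (h : below (eps00 k F) Q = below (eps01 k F) Q') :
    ∃ Q'' : Place (F ⊗[k] F), below (eps01 k F) Q'' = below (eps01 k F) Q ∧
      below (eps00 k F) Q'' = below (eps00 k F) Q' ∧ D Q'' = D Q + D Q' := by
  obtain ⟨R, rfl, rfl⟩ := exists_place_tensor_tensor Q Q' h
  rw [below_ofId_below] at hQ
  have hR := ramIdx_ofId_tensor_tensor_eq_one R hQ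
  refine ⟨below (eps11 k F) R, ?_, ?_, ?_⟩
  · rw [← below_comp, ← below_comp, eps11_comp_eps01]
  · rw [← below_comp, ← below_comp, eps11_comp_eps00]
  · have := DFunLike.congr_fun (AddMonoidHom.mem_ker.1 hD) R
    simp only [divDelta1, AddMonoidHom.add_apply, AddMonoidHom.sub_apply, Finsupp.add_apply,
      Finsupp.sub_apply, divMap_apply, ramIdx_eq_one_of_ofId _ hR, Finsupp.zero_apply] at this
    push_cast at this
    linarith

/-- Composing the loop with itself repeatedly gives places where `D` takes the values `(n + 1) * D
Q`, pairwise distinct and nonzero unless `D Q = 0`. -/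
theorem eq_zero_of_below_eq {Q : Place (F ⊗[k] F)}
    (hQ : ¬ Ramifies (Algebra.ofId k F) (below (Algebra.ofId k (F ⊗[k] F)) Q))
    (h : below (eps00 k F) Q = below (eps01 k F) Q) : D Q = 0 := by
  have key : ∀ n : ℕ, ∃ Q' : Place (F ⊗[k] F), below (eps01 k F) Q' = below (eps01 k F) Q ∧
      below (eps00 k F) Q' = below (eps00 k F) Q ∧ D Q' = (n + 1) * D Q := by
    intro n
    induction n with
    | zero => exact ⟨Q, rfl, rfl, by simp⟩
    | succ n ih =>
      obtain ⟨Q', h1, h2, h3⟩ := ih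
      obtain ⟨Q'', h1', h2', h3'⟩ := exists_comp_place hD hQ (h.trans h1.symm)
      exact ⟨Q'', h1', h2'.trans h2, by rw [h3', h3]; push_cast; ring⟩
  by_contra hne
  choose P _ _ hP using key
  have hmem : ∀ n, P n ∈ D.support := fun n =>
    Finsupp.mem_support_iff.2 (by rw [hP]; exact mul_ne_zero (by positivity) hne)
  refine not_injective_infinite_finite (fun n => (⟨P n, hmem n⟩ : D.support)) fun m n hmn => ?_
  have := congrArg D (congrArg Subtype.val hmn)
  simp only [hP] at this
  have := mul_right_cancel₀ hne this
  omega

theorem eq_of_below_eq {Q Q' : Place (F ⊗[k] F)}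
    (hQ : ¬ Ramifies (Algebra.ofId k F) (below (Algebra.ofId k (F ⊗[k] F)) Q))
    (h1 : below (eps01 k F) Q = below (eps01 k F) Q')
    (h0 : below (eps00 k F) Q = below (eps00 k F) Q') : D Q = D Q' := by
  have hQ' : ¬ Ramifies (Algebra.ofId k F) (below (Algebra.ofId k (F ⊗[k] F)) Q') := by
    rwa [← below_ofId_below (eps01 k F), ← h1, below_ofId_below]
  -- A return arrow `P`: both `Q` and `Q'` followed by `P` give loops, so each value is `-D P`.
  obtain ⟨P, hP1, hP0⟩ := exists_place_tensor (k := k) (below (eps00 k F) Q) (below (eps01 k F) Q)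
    (by rw [below_ofId_below, below_ofId_below])
  have loop : ∀ Q₁ : Place (F ⊗[k] F),
      ¬ Ramifies (Algebra.ofId k F) (below (Algebra.ofId k (F ⊗[k] F)) Q₁) →
      below (eps01 k F) Q = below (eps01 k F) Q₁ → below (eps00 k F) Q = below (eps00 k F) Q₁ →
      D Q₁ + D P = 0 := by
    intro Q₁ hQ₁ h1 h0
    obtain ⟨Q'', e1, e0, e⟩ := exists_comp_place hD hQ₁ (h0.symm.trans hP1.symm)
    rw [← e]
    refine eq_zero_of_below_eq hD ?_ (e0.trans (hP0.trans (h1.trans e1.symm)))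
    rwa [← below_ofId_below (eps01 k F), e1, below_ofId_below]
  linarith [loop Q hQ rfl rfl, loop Q' hQ' h1 h0]

end Cocycle

end Amitsur

end EtaleDivisor

/-! ### Construction of the primitive -/

open EtaleDivisor in
theorem exists_eq_divDelta0 {k : Type*} [Field k] [NumberField k] {F : Type*} [CommRing F]
    [Algebra k F] [Module.Finite k F] {D : Divisor (F ⊗[k] F)} (hD : D ∈ (divDelta1 k F).ker)
    (hsupp : ∀ Q ∈ D.support,
      ¬ Ramifies (Algebra.ofId k F) (below (Algebra.ofId k (F ⊗[k] F)) Q)) :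
    ∃ E : Divisor F, D = divDelta0 k F E := by
  classical
  -- Base points over `p`, as a function of `B` so that no place of `F` over `p` need exist; `id` is
  -- the vacuous case.
  have hbase : ∀ p : Place k, ∃ C : Place F → Place F,
      ∀ B, below (Algebra.ofId k F) B = p → below (Algebra.ofId k F) (C B) = p ∧
        ∀ B', below (Algebra.ofId k F) B' = p → C B = C B' := by
    intro p
    by_cases h : ∃ A, below (Algebra.ofId k F) A = p
    · obtain ⟨A, hA⟩ := h
      exact ⟨fun _ => A, fun _ _ => ⟨hA, fun _ _ => rfl⟩⟩
    · exact ⟨id, fun B hB => (h ⟨B, hB⟩).elim⟩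
  choose C hC using hbase
  let c : Place F → Place F := fun B => C (below (Algebra.ofId k F) B) B
  have hc : ∀ B, below (Algebra.ofId k F) (c B) = below (Algebra.ofId k F) B :=
    fun B => (hC _ B rfl).1
  have hcc : ∀ A B, below (Algebra.ofId k F) A = below (Algebra.ofId k F) B → c A = c B := by
    intro A B h
    change C _ A = C _ B
    rw [← h]
    exact (hC _ A rfl).2 B h.symm
  choose q hq1 hq0 using fun B => exists_place_tensor (k := k) (c B) B (hc B)
  have hqk : ∀ B, below (Algebra.ofId k (F ⊗[k] F)) (q B) = below (Algebra.ofId k F) B := by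
    intro B
    rw [← below_ofId_below (eps00 k F), hq0]
  let E : Divisor F := Finsupp.onFinset (D.support.image (below (eps00 k F))) (fun B => D (q B))
    fun B hB => Finset.mem_image.2 ⟨q B, Finsupp.mem_support_iff.2 hB, hq0 B⟩
  have hE : ∀ B, E B = D (q B) := fun B => rfl
  refine ⟨E, Finsupp.ext fun Q => ?_⟩
  simp only [divDelta0, AddMonoidHom.sub_apply, Finsupp.sub_apply, divMap_apply, hE]
  by_cases hQ : Ramifies (Algebra.ofId k F) (below (Algebra.ofId k (F ⊗[k] F)) Q)
  -- Ramification depends only on the place of `k`, so the support condition kills `D` on the whole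
  -- fibre, including the arrows defining `E`.
  · have hzero : ∀ P, below (Algebra.ofId k (F ⊗[k] F)) P = below (Algebra.ofId k (F ⊗[k] F)) Q →
        D P = 0 := fun P hP => by_contra fun hne =>
      hsupp P (Finsupp.mem_support_iff.2 hne) (hP ▸ hQ)
    rw [hzero Q rfl, hzero _ ((hqk _).trans (below_ofId_below _ _)),
      hzero _ ((hqk _).trans (below_ofId_below _ _))]
    simp
  · have h1 := ramIdx_ofId_tensor_eq_one Q hQ
    rw [ramIdx_eq_one_of_ofId _ h1, ramIdx_eq_one_of_ofId _ h1]
    have hA : ¬ Ramifies (Algebra.ofId k F)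
        (below (Algebra.ofId k (F ⊗[k] F)) (q (below (eps01 k F) Q))) := by
      rwa [hqk, below_ofId_below]
    -- The arrow from the base point to the source of `Q`, followed by `Q`, has the same endpoints
    -- as the chosen arrow to the target of `Q`.
    obtain ⟨Q', e1, e0, e⟩ := exists_comp_place hD hA (hq0 (below (eps01 k F) Q))
    have : D Q' = D (q (below (eps00 k F) Q)) := by
      refine eq_of_below_eq hD ?_ ?_ ?_
      · rwa [← below_ofId_below (eps01 k F), e1, below_ofId_below]
      · rw [e1, hq1, hq1]
        exact hcc _ _ (by rw [below_ofId_below, below_ofId_below])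
      · rw [e0, hq0]
    rw [← this, e]
    push_cast
    ring

theorem mainTheorem6 (k : Type*) [Field k] [NumberField k]
    (F : Type*) [CommRing F] [Algebra k F] [Algebra.Etale k F]
    (D : EtaleDivisor.Divisor (F ⊗[k] F))
    (hker : D ∈ (EtaleDivisor.divDelta1 k F).ker)
    (hsupp : ∀ Q ∈ D.support,
      ¬ EtaleDivisor.Ramifies (Algebra.ofId k F)
        (EtaleDivisor.below (Algebra.ofId k (F ⊗[k] F)) Q)) :
    ∃ E : EtaleDivisor.Divisor F, D = EtaleDivisor.divDelta0 k F E :=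
  exists_eq_divDelta0 hker hsupp
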